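/- Let $\mathcal A$ be a unital C*-algebra (over $\mathbb C$), and let $\mathcal V$ be a norm-closed complex linear subspace of $\mathcal A$ that is stable under the involution. Give each $M_n(\mathcal A)$ its unique C*-norm, give the vector space $\mathcal A/\mathcal V$ the involution $(A+\mathcal V)^* = A^*+\mathcal V$, and equip it with the quotient matrix norm, that is, give $M_n(\mathcal A/\mathcal V)\cong M_n(\mathcal A)/M_n(\mathcal V)$ the quotient norm for each $n$. Then there exist a Hilbert space $\mathcal H$, a unital $*$-representation $\pi$ of $\mathcal A$ on $\mathcal H$, an (orthogonal) projection $P$ on $\mathcal H$, and a Hermitian unitary operator $U$ on $\mathcal H$ that commutes with $\pi(A)$ for every $A\in\mathcal A$, such that the linear map $$\Psi:\mathcal A\to\mathcal L(\mathcal H),\qquad \Psi(A)=PU\pi(A)P,$$ vanishes on $\mathcal V$ and the induced linear map $\Phi:\mathcal A/\mathcal V\to\mathcal L(\mathcal H)$, $\Phi(A+\mathcal V)=\Psi(A)$, is a completely isometric $*$-map onto a $*$-subspace of $\mathcal L(\mathcal H)$: that is, $\Phi(x^*)=\Phi(x)^*$ for all $x\in\mathcal A/\mathcal V$, the range of $\Phi$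 is stable under the involution of $\mathcal L(\mathcal H)$, and for every $n$ the entrywise map $\Phi_n:M_n(\mathcal A/\mathcal V)\to M_n(\mathcal L(\mathcal H))$ is isometric, where $M_n(\mathcal L(\mathcal H))$ carries its C*-norm. -/

import Mathlib

universe u

noncomputable section

/-- A family of real-valued functions, one on each matrix space `M_n(W)`; the (semi)norms making up
a matrix norm on `W` are given in this form. -/
abbrev MatrixNormFamily (W : Type*) : Type _ :=
  ∀ n : ℕ, Matrix (Fin n) (Fin n) W → ℝ

/-- The canonical matrix norm of a C*-algebra `A`: on `M_n(A)` it is the unique C*-algebra norm,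
which Mathlib puts on `CStarMatrix (Fin n) (Fin n) A`. (Mathlib's construction refers to the
order of `A`; we supply the canonical one, whose positive elements are the `star a * a`.) -/
def cstarMatrixNorm (A : Type*) [CStarAlgebra A] : MatrixNormFamily A := fun _ C =>
  letI : PartialOrder A := CStarAlgebra.spectralOrder A
  letI : StarOrderedRing A := CStarAlgebra.spectralOrderedRing A
  ‖CStarMatrix.ofMatrix C‖

/-- The quotient matrix norm on `A ⧸ V`: the quotient norm of `M_n(A) / M_n(V) = M_n(A ⧸ V)`,
i.e. the infimum of the norms of all lifts of a given matrix to `M_n(A)`. -/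
def quotientMatrixNorm {A : Type*} [CStarAlgebra A] (V : Submodule ℂ A) :
    MatrixNormFamily (A ⧸ V) := fun n X =>
  sInf {r : ℝ | ∃ C : Matrix (Fin n) (Fin n) A, C.map V.mkQ = X ∧ cstarMatrixNorm A n C = r}

/-- A linear map is a complete isometry if all its entrywise amplifications to matrices preserve
the norms. -/
def IsCompleteIsometry {W W' : Type*} [AddCommGroup W] [Module ℂ W] [AddCommGroup W'] [Module ℂ W']
    (N : MatrixNormFamily W) (N' : MatrixNormFamily W') (φ : W →ₗ[ℂ] W') : Prop :=
  ∀ (n : ℕ) (X : Matrix (Fin n) (Fin n) W), N' n (X.map φ) = N n X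

/-- The involution on `A ⧸ V` induced by that of `A`, for a star-stable subspace `V`:
the class of `a` is sent to the class of `star a`. -/
def quotientStar {A : Type*} [CStarAlgebra A] (V : Submodule ℂ A)
    (hV : ∀ a ∈ V, star a ∈ V) : (A ⧸ V) →ₗ⋆[ℂ] (A ⧸ V) :=
  V.mapQ V ((starLinearEquiv ℂ : A ≃ₗ⋆[ℂ] A) : A →ₗ⋆[ℂ] A) hV

theorem quotientStar_mkQ {A : Type*} [CStarAlgebra A] (V : Submodule ℂ A)
    (hV : ∀ a ∈ V, star a ∈ V) (a : A) :
    quotientStar V hV (V.mkQ a) = V.mkQ (star a) := rfl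

end

section

open scoped ComplexOrder InnerProductSpace

/-! ### Positive extensions -/

/-! For each matrix `X` over `A`, Hahn–Banach gives a contractive functional on `M_n(A)` that kills
`M_n(V)` and takes at `X` the distance to `M_n(V)`. Such a functional has the form `⟪y, σ(·) x⟫`
with `‖x‖, ‖y‖ ≤ 1` (`exists_representation_of_functional`): it is placed in the off-diagonal corner
of a positive functional on 2×2 matrices, to which GNS applies. Matrix units turn this into a
representation of `A` with tuples of vectors (`exists_representation_of_infDist`).

The direct sum over all `n` and `X` is one representation `σ` with projections `p`, `q` such that `q
σ(·) p` kills `V` and attains every quotient matrix norm (`exists_representation_projections`). This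
compression need not respect the involution. On `L ⊕ L`, with `π = σ ⊕ σ`, `P = p ⊕ q` and `U` the
flip, `P U π(a) P` has off-diagonal entries `p σ(a) q` and `q σ(a) p` and zero diagonal. It is a
*-map because `U` commutes with `π`, and it kills `V` because `V` is star-stable. -/

/-- A real functional that is nonnegative on all elements with nonnegative real part is the real
part of a positive functional. -/
theorem exists_positiveLinearMap_re_eq {E : Type*} [CStarAlgebra E] [PartialOrder E]
    [StarOrderedRing E] (φ : E →ₗ[ℝ] ℝ) (hφ : ∀ x : E, 0 ≤ x + star x → 0 ≤ φ x) :
    ∃ F : E →ₚ[ℂ] ℂ, ∀ x, F x = (φ x : ℂ) - Complex.I * (φ (Complex.I • x) : ℂ) := by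
  have hskew : ∀ x : E, x + star x = 0 → φ x = 0 := by
    intro x hx
    refine le_antisymm ?_ (hφ x hx.ge)
    have := hφ (-x) (by rw [star_neg, ← neg_add, hx, neg_zero])
    rw [map_neg] at this
    linarith
  refine ⟨PositiveLinearMap.mk₀ (Module.Dual.extendRCLike φ) ?_, ?_⟩
  · intro x hx
    have hx' : star x = x := (IsSelfAdjoint.of_nonneg hx).star_eq
    have h1 : φ (Complex.I • x) = 0 := hskew _ (by simp [hx'])
    have h2 : 0 ≤ φ x := hφ x (by rw [hx']; exact add_nonneg hx hx)
    rw [Module.Dual.extendRCLike_apply]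
    simp only [RCLike.I_to_complex, h1]
    simpa using h2
  · intro x
    exact Module.Dual.extendRCLike_apply φ x

/-- The unit is an order unit; this is the cofinality condition in the Riesz extension theorem. -/
theorem exists_add_star_nonneg {E : Type*} [CStarAlgebra E] [PartialOrder E] [StarOrderedRing E]
    (y : E) : ∃ r : ℝ, 0 ≤ ((r : ℂ) • (1 : E) + y) + star ((r : ℂ) • (1 : E) + y) := by
  refine ⟨‖y + star y‖, ?_⟩
  have h : IsSelfAdjoint (y + star y) := IsSelfAdjoint.add_star_self y
  have h1 := h.neg_algebraMap_norm_le_self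
  have h2 : (0 : E) ≤ algebraMap ℝ E ‖y + star y‖ := algebraMap_nonneg E (norm_nonneg _)
  have h3 : ((‖y + star y‖ : ℝ) : ℂ) • (1 : E) = algebraMap ℝ E ‖y + star y‖ := by
    rw [Algebra.algebraMap_eq_smul_one, Complex.coe_smul]
  rw [star_add, star_smul, star_one, Complex.star_def, Complex.conj_ofReal, h3]
  have h4 : algebraMap ℝ E ‖y + star y‖ + y + (algebraMap ℝ E ‖y + star y‖ + star y)
      = algebraMap ℝ E ‖y + star y‖ + ((y + star y) - -algebraMap ℝ E ‖y + star y‖) := by abel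
  rw [h4]
  exact add_nonneg h2 (sub_nonneg.mpr h1)

/-- Krein's extension theorem: a real functional on (the image of) a real vector space `X` which
contains the unit and on which it is nonnegative at elements with nonnegative real part extends
to a positive functional. -/
theorem exists_positive_extension {E X : Type*} [CStarAlgebra E] [PartialOrder E]
    [StarOrderedRing E] [AddCommGroup X] [Module ℝ X] (ι : X →ₗ[ℝ] E) (f : X →ₗ[ℝ] ℝ)
    (e : X) (he : ι e = 1) (hf : ∀ x, 0 ≤ ι x + star (ι x) → 0 ≤ f x) :
    ∃ F : E →ₚ[ℂ] ℂ, ∀ x, (F (ι x)).re = f x := by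
  -- `ι` need not be injective: `hf` at `x` and `-x` shows that `f` descends to the range of `ι`.
  have hker : f ∈ (LinearMap.ker ι).dualAnnihilator := by
    rw [Submodule.mem_dualAnnihilator]
    intro x hx
    rw [LinearMap.mem_ker] at hx
    have h1 := hf x (by simp [hx])
    have h2 := hf (-x) (by simp [hx])
    rw [map_neg] at h2
    linarith
  rw [← LinearMap.range_dualMap_eq_dualAnnihilator_ker] at hker
  obtain ⟨g, rfl⟩ := hker
  -- The cone of elements with nonnegative real part, rather than the positive cone, because the
  -- range of `ι` need not be star-stable.
  let s : PointedCone ℝ E :=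
    { carrier := {x | 0 ≤ x + star x}
      add_mem' := fun {a b} ha hb => by
        have h : a + b + star (a + b) = (a + star a) + (b + star b) := by rw [star_add]; abel
        simp only [Set.mem_ofPred_eq] at ha hb ⊢
        rw [h]
        exact add_nonneg ha hb
      zero_mem' := by simp
      smul_mem' := fun c x hx => by
        simp only [Set.mem_ofPred_eq] at hx ⊢
        have h : c • x + star (c • x) = (c : ℝ) • (x + star x) := by
          rw [smul_add]
          congr 1
          exact (star_smul (c : ℝ) x).trans (by rw [star_trivial])
        rw [h]
        exact smul_nonneg c.2 hx }
  obtain ⟨φ, h1, h2⟩ := riesz_extension s ⟨LinearMap.range ι, g ∘ₗ (LinearMap.range ι).subtype⟩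
    (by
      rintro ⟨_, x, rfl⟩ hx
      exact hf x hx)
    (by
      intro y
      obtain ⟨r, hr⟩ := exists_add_star_nonneg y
      refine ⟨⟨(r : ℂ) • (1 : E), r • e, ?_⟩, hr⟩
      rw [map_smul, he, Complex.coe_smul])
  obtain ⟨F, hF⟩ := exists_positiveLinearMap_re_eq φ h2
  refine ⟨F, fun x => ?_⟩
  rw [hF, h1 ⟨ι x, x, rfl⟩]
  simp

/-! ### Vector functionals -/

theorem exists_eq_star_mul_self_of_nonneg {E : Type*} [CStarAlgebra E] [PartialOrder E]
    [StarOrderedRing E] {a : E} (ha : 0 ≤ a) : ∃ b, a = star b * b :=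
  CStarAlgebra.nonneg_iff_eq_star_mul_self.mp ha

theorem nonneg_of_algebraMap_nonneg {B : Type*} [CStarAlgebra B] [PartialOrder B]
    [StarOrderedRing B] [Nontrivial B] {r : ℝ} (h : 0 ≤ algebraMap ℝ B r) : 0 ≤ r := by
  have := spectrum_nonneg_of_nonneg h (x := r) (by rw [spectrum.scalar_eq]; rfl)
  exact this

namespace CStarMatrix

/-- The embedding of an algebra into its matrix algebra as scalar matrices. -/
def diagonalStarAlgHom (n B : Type*) [Fintype n] [DecidableEq n] [CStarAlgebra B] :
    B →⋆ₐ[ℂ] CStarMatrix n n B where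
  toFun b := ofMatrix (Matrix.diagonal fun _ => b)
  map_one' := rfl
  map_mul' a b := by
    ext i j
    simp [mul_apply, Matrix.diagonal_apply, ofMatrix_apply]
  map_zero' := by ext i j; simp
  map_add' a b := by
    ext i j
    simp only [ofMatrix_apply, Matrix.diagonal_apply, add_apply]
    split_ifs <;> simp
  commutes' r := by
    ext i j
    simp [algebraMap_apply, Matrix.diagonal_apply]
  map_star' a := by
    ext i j
    rw [star_apply]
    simp only [ofMatrix_apply, Matrix.diagonal_apply, eq_comm]
    split_ifs <;> simp

theorem diagonalStarAlgHom_apply {n B : Type*} [Fintype n] [DecidableEq n] [CStarAlgebra B]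
    (b : B) (i j : n) : diagonalStarAlgHom n B b i j = if i = j then b else 0 := rfl

/-- The matrix with the entry `b` at position `(i, j)` and zeros elsewhere. -/
def unit {n B : Type*} [DecidableEq n] [Zero B] (i j : n) (b : B) : CStarMatrix n n B :=
  ofMatrix (Matrix.single i j b)

theorem unit_apply {n B : Type*} [DecidableEq n] [Zero B] (i j k l : n) (b : B) :
    unit i j b k l = if i = k ∧ j = l then b else 0 := rfl

theorem unit_mul_unit {n B : Type*} [Fintype n] [DecidableEq n] [CStarAlgebra B]
    (i j k : n) (a b : B) : unit i j a * unit j k b = unit i k (a * b) :=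
  Matrix.single_mul_single_same (c := a) i j k b

theorem diagonalStarAlgHom_mul_unit {n B : Type*} [Fintype n] [DecidableEq n] [CStarAlgebra B]
    (a b : B) (i j : n) : diagonalStarAlgHom n B a * unit i j b = unit i j (a * b) := by
  ext k l
  refine (Matrix.diagonal_mul _ (Matrix.single i j b) _ _).trans ?_
  rw [unit_apply, Matrix.single_apply, mul_ite, mul_zero]

theorem star_unit {n B : Type*} [DecidableEq n] [CStarAlgebra B]
    (i j : n) (b : B) : star (unit i j b) = unit j i (star b) :=
  Matrix.conjTranspose_single i j b

theorem exists_eq_star_mul_self_of_nonneg {n B : Type*} [Fintype n] [DecidableEq n]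
    [CStarAlgebra B] [PartialOrder B] [StarOrderedRing B] {T : CStarMatrix n n B} (hT : 0 ≤ T) :
    ∃ S, T = star S * S :=
  _root_.exists_eq_star_mul_self_of_nonneg hT

/-- With `b = T 0 1`, evaluating the form of `T = S⋆S` at the column `(-b, ‖b‖)` gives `2‖b‖ b⋆b ≤ α
b⋆b + β‖b‖²`. Taking norms and dividing by `‖b‖²` finishes. -/
theorem norm_le_of_nonneg {B : Type*} [CStarAlgebra B] [PartialOrder B] [StarOrderedRing B]
    [Nontrivial B] {T : CStarMatrix (Fin 2) (Fin 2) B} (hT : 0 ≤ T) {α β : ℝ}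
    (h0 : T 0 0 = algebraMap ℝ B α) (h1 : T 1 1 = algebraMap ℝ B β) :
    2 * ‖T 0 1‖ ≤ α + β := by
  obtain ⟨S, rfl⟩ := exists_eq_star_mul_self_of_nonneg hT
  simp only [mul_apply, star_apply, Fin.sum_univ_two] at h0 h1 ⊢
  set b := star (S 0 0) * S 0 1 + star (S 1 0) * S 1 1 with hb
  have hα : 0 ≤ α := by
    refine nonneg_of_algebraMap_nonneg (B := B) ?_
    rw [← h0]
    exact add_nonneg (star_mul_self_nonneg _) (star_mul_self_nonneg _)
  have hβ : 0 ≤ β := by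
    refine nonneg_of_algebraMap_nonneg (B := B) ?_
    rw [← h1]
    exact add_nonneg (star_mul_self_nonneg _) (star_mul_self_nonneg _)
  rcases (norm_nonneg b).eq_or_lt with h | hpos
  · rw [← h]; linarith
  let x : B := -b
  let y : B := algebraMap ℝ B ‖b‖
  have hy : star y = y := by simp [y, ← algebraMap_star_comm]
  have hp : 0 ≤ star (S 0 0 * x + S 0 1 * y) * (S 0 0 * x + S 0 1 * y)
      + star (S 1 0 * x + S 1 1 * y) * (S 1 0 * x + S 1 1 * y) :=
    add_nonneg (star_mul_self_nonneg _) (star_mul_self_nonneg _)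
  have he : star (S 0 0 * x + S 0 1 * y) * (S 0 0 * x + S 0 1 * y)
      + star (S 1 0 * x + S 1 1 * y) * (S 1 0 * x + S 1 1 * y)
      = star x * (star (S 0 0) * S 0 0 + star (S 1 0) * S 1 0) * x
        + star x * b * y + y * star b * x
        + y * (star (S 0 1) * S 0 1 + star (S 1 1) * S 1 1) * y := by
    rw [hb]
    simp only [star_add, star_mul, star_star, hy]
    noncomm_ring
  rw [he, h0, h1] at hp
  have he2 : star x * algebraMap ℝ B α * x + star x * b * y + y * star b * x
      + y * algebraMap ℝ B β * y
      = (α • (star b * b) + algebraMap ℝ B (β * ‖b‖ ^ 2)) - (2 * ‖b‖) • (star b * b) := by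
    simp only [x, y, Algebra.algebraMap_eq_smul_one, star_neg]
    simp only [mul_smul_comm, smul_mul_assoc, mul_one, one_mul, neg_mul, mul_neg, neg_neg,
      smul_neg, smul_smul, two_mul, add_smul, pow_two]
    module
  rw [he2, sub_nonneg] at hp
  have hn := CStarAlgebra.norm_le_norm_of_nonneg_of_le
    (smul_nonneg (by positivity) (star_mul_self_nonneg b)) hp
  have hn2 : 2 * ‖b‖ * ‖b‖ ^ 2 ≤ α * ‖b‖ ^ 2 + β * ‖b‖ ^ 2 := by
    refine le_trans (le_of_eq ?_) (hn.trans ((norm_add_le _ _).trans (le_of_eq ?_)))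
    · rw [norm_smul, CStarRing.norm_star_mul_self, Real.norm_of_nonneg (by positivity)]
      ring
    · rw [norm_smul, CStarRing.norm_star_mul_self, norm_algebraMap', Real.norm_of_nonneg hα,
        Real.norm_of_nonneg (by positivity)]
      ring
  have : 0 < ‖b‖ ^ 2 := by positivity
  nlinarith

end CStarMatrix

/-- On upper triangular matrices with real diagonal `l, m` and corner `b`, take `l + m + Re f(b)`.
If the real part of the matrix is positive, then `‖b‖ ≤ l + m`, so this value is nonnegative and
Krein's theorem applies. -/
theorem exists_positiveLinearMap_corner {B : Type*} [CStarAlgebra B] [PartialOrder B]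
    [StarOrderedRing B] [Nontrivial B] (f : StrongDual ℂ B) (hf : ‖f‖ ≤ 1) :
    ∃ F : CStarMatrix (Fin 2) (Fin 2) B →ₚ[ℂ] ℂ, F (CStarMatrix.unit 0 0 1) = 1 ∧
      F (CStarMatrix.unit 1 1 1) = 1 ∧ ∀ b, F (CStarMatrix.unit 0 1 b) = f b := by
  let ι : (ℝ × ℝ × B) →ₗ[ℝ] CStarMatrix (Fin 2) (Fin 2) B :=
    { toFun := fun p => CStarMatrix.ofMatrix
        !![algebraMap ℝ B p.1, p.2.2; 0, algebraMap ℝ B p.2.1]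
      map_add' := fun p q => by
        ext i j
        fin_cases i <;> fin_cases j <;> simp [CStarMatrix.ofMatrix_apply]
      map_smul' := fun r p => by
        ext i j
        fin_cases i <;> fin_cases j <;>
          simp [CStarMatrix.ofMatrix_apply, Algebra.algebraMap_eq_smul_one, smul_smul] }
  let g : (ℝ × ℝ × B) →ₗ[ℝ] ℝ :=
    { toFun := fun p => p.1 + p.2.1 + (f p.2.2).re
      map_add' := fun p q => by simp; ring
      map_smul' := fun r p => by
        have : f (r • p.2.2) = r • f p.2.2 := by
          rw [← Complex.coe_smul, map_smul, Complex.coe_smul]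
        simp [this]; ring }
  let M : (ℝ × ℝ × B) → CStarMatrix (Fin 2) (Fin 2) B := fun p => CStarMatrix.ofMatrix
    !![algebraMap ℝ B p.1, p.2.2; 0, algebraMap ℝ B p.2.1]
  have hM : ∀ p, M p = CStarMatrix.ofMatrix
    !![algebraMap ℝ B p.1, p.2.2; 0, algebraMap ℝ B p.2.1] := fun _ => rfl
  have hg : ∀ p, g p = p.1 + p.2.1 + (f p.2.2).re := fun _ => rfl
  have hM1 : M (1, 1, 0) = 1 := by
    ext i j
    rw [hM]
    fin_cases i <;> fin_cases j <;> simp [CStarMatrix.ofMatrix_apply]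
  have hpos : ∀ p, 0 ≤ M p + star (M p) → 0 ≤ g p := by
    rintro ⟨l, m, b⟩ h
    rw [hM] at h
    have := CStarMatrix.norm_le_of_nonneg h (α := 2 * l) (β := 2 * m)
      (by simp [CStarMatrix.star_apply, CStarMatrix.ofMatrix_apply, ← algebraMap_star_comm,
            two_mul])
      (by simp [CStarMatrix.star_apply, CStarMatrix.ofMatrix_apply, ← algebraMap_star_comm,
            two_mul])
    simp only [CStarMatrix.add_apply, CStarMatrix.star_apply, CStarMatrix.ofMatrix_apply] at this
    simp only [Matrix.cons_val_zero, Matrix.cons_val_one, Matrix.of_apply, Matrix.cons_val',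
      star_zero, add_zero] at this
    rw [hg]
    have h3 : |(f b).re| ≤ ‖b‖ :=
      (Complex.abs_re_le_norm _).trans ((f.le_of_opNorm_le hf b).trans (by rw [one_mul]))
    have := abs_le.mp h3
    simp only
    linarith
  obtain ⟨F, hF⟩ : ∃ F : CStarMatrix (Fin 2) (Fin 2) B →ₚ[ℂ] ℂ, ∀ p, (F (M p)).re = g p :=
    exists_positive_extension ι g (1, 1, 0) hM1 hpos
  -- The extension controls only real parts; the diagonal units are positive, so their values are
  -- real.
  have hunit : ∀ i : Fin 2, (F (CStarMatrix.unit i i 1)).im = 0 := by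
    intro i
    have h0 : 0 ≤ F (CStarMatrix.unit i i 1) := by
      refine F.map_nonneg ?_
      have := star_mul_self_nonneg (CStarMatrix.unit i i (1 : B))
      rwa [CStarMatrix.star_unit, CStarMatrix.unit_mul_unit, star_one, one_mul] at this
    exact (Complex.nonneg_iff.mp h0).2.symm
  refine ⟨F, Complex.ext ?_ (hunit 0), Complex.ext ?_ (hunit 1), fun b => ?_⟩
  · have : CStarMatrix.unit 0 0 1 = M (1, 0, 0) := by
      ext i j
      rw [hM]
      fin_cases i <;> fin_cases j <;> simp [CStarMatrix.ofMatrix_apply, CStarMatrix.unit_apply]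
    rw [this, hF, hg]
    simp
  · have : CStarMatrix.unit 1 1 1 = M (0, 1, 0) := by
      ext i j
      rw [hM]
      fin_cases i <;> fin_cases j <;> simp [CStarMatrix.ofMatrix_apply, CStarMatrix.unit_apply]
    rw [this, hF, hg]
    simp
  · have hb : ∀ b, CStarMatrix.unit 0 1 b = M (0, 0, b) := by
      intro b
      ext i j
      rw [hM]
      fin_cases i <;> fin_cases j <;> simp [CStarMatrix.ofMatrix_apply, CStarMatrix.unit_apply]
    have hI : (CStarMatrix.unit 0 1 (Complex.I • b) : CStarMatrix (Fin 2) (Fin 2) B)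
        = Complex.I • CStarMatrix.unit 0 1 b := by
      ext i j
      simp [CStarMatrix.unit_apply]
    have hre : ∀ b, (F (CStarMatrix.unit 0 1 b)).re = (f b).re := by
      intro b
      rw [hb, hF, hg]
      simp
    have him := hre (Complex.I • b)
    rw [hI, map_smul, map_smul] at him
    refine Complex.ext (hre b) ?_
    simpa using him

/-- Every contractive functional on a unital C*-algebra is a vector functional, given by vectors
of norm at most one, in a representation. -/
theorem exists_representation_of_functional {B : Type u} [CStarAlgebra B] [PartialOrder B]
    [StarOrderedRing B] [Nontrivial B] (f : StrongDual ℂ B) (hf : ‖f‖ ≤ 1) :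
    ∃ (K : Type u) (_ : NormedAddCommGroup K) (_ : InnerProductSpace ℂ K) (_ : CompleteSpace K)
      (σ : B →⋆ₐ[ℂ] (K →L[ℂ] K)) (x y : K), ‖x‖ ≤ 1 ∧ ‖y‖ ≤ 1 ∧
      ∀ b, f b = inner ℂ y (σ b x) := by
  obtain ⟨F, h0, h1, hF⟩ := exists_positiveLinearMap_corner f hf
  have hx : ‖F.toPreGNS (CStarMatrix.unit 0 1 1)‖ ≤ 1 := by
    rw [F.preGNS_norm_def, PositiveLinearMap.ofPreGNS_toPreGNS, CStarMatrix.star_unit,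
      CStarMatrix.unit_mul_unit, star_one, one_mul, h1]
    simp
  have hy : ‖F.toPreGNS (CStarMatrix.unit 0 0 1)‖ ≤ 1 := by
    rw [F.preGNS_norm_def, PositiveLinearMap.ofPreGNS_toPreGNS, CStarMatrix.star_unit,
      CStarMatrix.unit_mul_unit, star_one, one_mul, h0]
    simp
  -- The vectors are the classes of the units `e₀₁` and `e₀₀`: `⟪y, σ(b) x⟫ = F(e₀₀⋆ (b e₀₁)) = F(b
  -- e₀₁) = f b`.
  refine ⟨F.GNS, inferInstance, inferInstance, inferInstance,
    F.gnsStarAlgHom.comp (CStarMatrix.diagonalStarAlgHom (Fin 2) B),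
    (F.toPreGNS (CStarMatrix.unit 0 1 1) : F.PreGNS),
    (F.toPreGNS (CStarMatrix.unit 0 0 1) : F.PreGNS), ?_, ?_, fun b => ?_⟩
  · rwa [UniformSpace.Completion.norm_coe]
  · rwa [UniformSpace.Completion.norm_coe]
  · have : F.gnsStarAlgHom (CStarMatrix.diagonalStarAlgHom (Fin 2) B b)
        (F.toPreGNS (CStarMatrix.unit 0 1 1) : F.PreGNS)
        = (F.toPreGNS (CStarMatrix.unit 0 1 b) : F.PreGNS) := by
      refine (F.gnsNonUnitalStarAlgHom_apply_coe).trans ?_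
      rw [F.leftMulMapPreGNS_apply]
      simp [CStarMatrix.diagonalStarAlgHom_mul_unit]
    rw [StarAlgHom.comp_apply, this, UniformSpace.Completion.inner_coe, F.preGNS_inner_def,
      PositiveLinearMap.ofPreGNS_toPreGNS, PositiveLinearMap.ofPreGNS_toPreGNS,
      CStarMatrix.star_unit, CStarMatrix.unit_mul_unit, star_one, one_mul, hF]

/-! ### Operators on direct sums of Hilbert spaces -/

/-- The direct sum of a family of representations. -/
theorem exists_directSum_representation {A : Type*} [CStarAlgebra A] {ι : Type*} {K : ι → Type*}
    [∀ i, NormedAddCommGroup (K i)] [∀ i, InnerProductSpace ℂ (K i)] [∀ i, CompleteSpace (K i)]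
    (π : ∀ i, A →⋆ₐ[ℂ] (K i →L[ℂ] K i)) :
    ∃ σ : A →⋆ₐ[ℂ] (lp K 2 →L[ℂ] lp K 2), ∀ a f i, σ a f i = π i a (f i) := by
  have hle : ∀ a (f : lp K 2) i, ‖π i a (f i)‖ ≤ ‖(((‖a‖ : ℝ) : ℂ) • f : lp K 2) i‖ := by
    intro a f i
    rw [lp.coeFn_smul, Pi.smul_apply, norm_smul, Complex.norm_real, norm_norm]
    exact (π i a).le_of_opNorm_le (NonUnitalStarAlgHom.norm_apply_le (π i) a) _
  have hmem : ∀ a (f : lp K 2), Memℓp (fun i => π i a (f i)) 2 := fun a f =>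
    (lp.memℓp (((‖a‖ : ℝ) : ℂ) • f)).mono' (hle a f)
  let T : A → (lp K 2 →L[ℂ] lp K 2) := fun a => LinearMap.mkContinuous
    { toFun := fun f => ⟨fun i => π i a (f i), hmem a f⟩
      map_add' := fun f g => by
        ext i
        exact map_add (π i a) (f i) (g i)
      map_smul' := fun c f => by
        ext i
        exact map_smul (π i a) c (f i) } ‖a‖ (fun f => by
      refine (lp.norm_mono (p := 2) (by simp) (hle a f)).trans ?_
      rw [norm_smul, Complex.norm_real, norm_norm])
  have hT : ∀ a f i, T a f i = π i a (f i) := fun _ _ _ => rfl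
  refine ⟨
    { toFun := T
      map_one' := by ext f i; simp [hT]
      map_mul' := fun a b => by ext f i; simp [hT]
      map_zero' := by ext f i; simp [hT]
      map_add' := fun a b => by ext f i; simp [hT]
      commutes' := fun r => by
        ext f i
        simp [hT, Algebra.algebraMap_eq_smul_one]
      map_star' := fun a => by
        rw [ContinuousLinearMap.star_eq_adjoint, ContinuousLinearMap.eq_adjoint_iff]
        intro f g
        rw [lp.inner_eq_tsum, lp.inner_eq_tsum]
        refine tsum_congr fun i => ?_
        rw [hT, hT, map_star, ContinuousLinearMap.star_eq_adjoint,
          ContinuousLinearMap.adjoint_inner_left] }, hT⟩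

/-- Matrices of operators act on the direct sum of copies of the Hilbert space. -/
theorem exists_matrix_action (n H : Type*) [Fintype n] [DecidableEq n] [NormedAddCommGroup H]
    [InnerProductSpace ℂ H] [CompleteSpace H] :
    ∃ σ : CStarMatrix n n (H →L[ℂ] H) →⋆ₐ[ℂ]
        (PiLp 2 (fun _ : n => H) →L[ℂ] PiLp 2 (fun _ : n => H)),
      ∀ M x i, σ M x i = ∑ j, M i j (x j) := by
  let T : CStarMatrix n n (H →L[ℂ] H) → (PiLp 2 (fun _ : n => H) →L[ℂ] PiLp 2 (fun _ : n => H)) :=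
    fun M => (PiLp.continuousLinearEquiv 2 ℂ (fun _ : n => H)).symm.toContinuousLinearMap ∘L
      (ContinuousLinearMap.pi fun i => ∑ j, M i j ∘L PiLp.proj 2 (fun _ : n => H) j)
  have hT : ∀ M x i, T M x i = ∑ j, M i j (x j) := fun M x i => by
    simp [T]
  refine ⟨
    { toFun := T
      map_one' := by
        ext x i
        rw [hT, Finset.sum_eq_single i]
        · simp
        · intro j _ hj
          simp [CStarMatrix.one_apply_ne' hj]
        · simp
      map_mul' := fun a b => by
        ext x i
        have h : (T a * T b) x = T a (T b x) := rfl
        simp only [h, hT, CStarMatrix.mul_apply, sum_apply, map_sum]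
        exact Finset.sum_comm
      map_zero' := by ext x i; simp [hT]
      map_add' := fun a b => by ext x i; simp [hT, Finset.sum_add_distrib]
      commutes' := fun r => by
        ext x i
        rw [hT, Finset.sum_eq_single i]
        · simp [CStarMatrix.algebraMap_apply, Algebra.algebraMap_eq_smul_one]
        · intro j _ hj
          simp [CStarMatrix.algebraMap_apply, hj.symm]
        · simp
      map_star' := fun M => by
        rw [ContinuousLinearMap.star_eq_adjoint, ContinuousLinearMap.eq_adjoint_iff]
        intro x y
        rw [PiLp.inner_apply, PiLp.inner_apply]
        simp only [hT, sum_inner, inner_sum]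
        rw [Finset.sum_comm]
        refine Finset.sum_congr rfl fun i _ => Finset.sum_congr rfl fun j _ => ?_
        rw [CStarMatrix.star_apply, ContinuousLinearMap.star_eq_adjoint,
          ContinuousLinearMap.adjoint_inner_left] }, hT⟩

theorem CStarMatrix.sum_unit_one (n B : Type*) [Fintype n] [DecidableEq n] [CStarAlgebra B] :
    ∑ i : n, CStarMatrix.unit i i (1 : B) = 1 :=
  Matrix.sum_single_one

theorem CStarMatrix.sum_unit {n B : Type*} [Fintype n] [DecidableEq n] [CStarAlgebra B]
    (X : CStarMatrix n n B) : ∑ i, ∑ j, CStarMatrix.unit i j (X i j) = X :=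
  (Matrix.matrix_eq_sum_single X).symm

/-- The matrices with entries in a given subspace. -/
def matrixSubmodule {A : Type*} [CStarAlgebra A] (V : Submodule ℂ A) (n : Type*) :
    Submodule ℂ (CStarMatrix n n A) where
  carrier := {C | ∀ i j, C i j ∈ V}
  add_mem' ha hb i j := V.add_mem (ha i j) (hb i j)
  zero_mem' _ _ := V.zero_mem
  smul_mem' c _ ha i j := V.smul_mem c (ha i j)

/-- A contractive functional vanishing on a subspace and attaining the distance to it. -/
theorem exists_functional_eq_infDist {B : Type*} [NormedAddCommGroup B] [NormedSpace ℂ B]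
    (W : Submodule ℂ B) (X : B) : ∃ f : StrongDual ℂ B, ‖f‖ ≤ 1 ∧ (∀ w ∈ W, f w = 0) ∧
      f X = (Metric.infDist X (W : Set B) : ℂ) := by
  obtain ⟨g, hg, hgX⟩ := exists_dual_vector'' ℂ (W.mkQ X)
  refine ⟨LinearMap.mkContinuous (g.toLinearMap ∘ₗ W.mkQ) 1 fun b => ?_, ?_, fun w hw => ?_, ?_⟩
  · rw [one_mul]
    refine (g.le_of_opNorm_le hg _).trans ?_
    rw [one_mul]
    exact Submodule.Quotient.norm_mk_le W b
  · exact LinearMap.mkContinuous_norm_le _ zero_le_one _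
  · have : W.mkQ w = 0 := by rwa [Submodule.mkQ_apply, Submodule.Quotient.mk_eq_zero]
    change g (W.mkQ w) = 0
    rw [this, map_zero]
  · change g (W.mkQ X) = _
    rw [hgX]
    congr 1
    exact QuotientAddGroup.norm_mk (S := W.toAddSubgroup) X

/-- Since `e_kj⋆ e_kj = e_jj`, the sum is `⟪x, σ(∑ e_jj) x⟫`, and the `e_jj` add up to `1`. -/
theorem sum_norm_sq_unit_apply {n A K : Type*} [Fintype n] [DecidableEq n] [CStarAlgebra A]
    [NormedAddCommGroup K] [InnerProductSpace ℂ K] [CompleteSpace K]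
    (σ : CStarMatrix n n A →⋆ₐ[ℂ] (K →L[ℂ] K)) (k : n) (x : K) :
    ∑ j, ‖σ (CStarMatrix.unit k j 1) x‖ ^ 2 = ‖x‖ ^ 2 := by
  have h : ∀ j, ((‖σ (CStarMatrix.unit k j 1) x‖ ^ 2 : ℝ) : ℂ)
      = ⟪x, σ (CStarMatrix.unit j j 1) x⟫_ℂ := by
    intro j
    have h1 : σ (CStarMatrix.unit j j 1)
        = star (σ (CStarMatrix.unit k j 1)) * σ (CStarMatrix.unit k j 1) := by
      rw [← map_star, ← map_mul, CStarMatrix.star_unit, CStarMatrix.unit_mul_unit, star_one,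
        one_mul]
    rw [h1, mul_apply_eq_comp, ContinuousLinearMap.star_eq_adjoint,
      ContinuousLinearMap.adjoint_inner_right, inner_self_eq_norm_sq_to_K]
    norm_cast
  apply Complex.ofReal_injective
  rw [Complex.ofReal_sum, Finset.sum_congr rfl fun j _ => h j, ← inner_sum]
  rw [← sum_apply, ← map_sum, CStarMatrix.sum_unit_one, map_one, one_apply_eq_self,
    inner_self_eq_norm_sq_to_K]
  norm_cast

/-- For a fixed row `k`, put `ξ_j = σ(e_kj) x` and `η_i = σ(e_ki) y`. Since `e_ki⋆ a e_kj` is the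
matrix with entry `a` at `(i, j)`, pairing these vectors recovers the functional entry by entry. -/
theorem exists_representation_of_infDist {A : Type u} [CStarAlgebra A] [PartialOrder A]
    [StarOrderedRing A] (V : Submodule ℂ A) {n : Type} [Fintype n] [DecidableEq n]
    (X : CStarMatrix n n A) :
    ∃ (K : Type u) (_ : NormedAddCommGroup K) (_ : InnerProductSpace ℂ K) (_ : CompleteSpace K)
      (π : A →⋆ₐ[ℂ] (K →L[ℂ] K)) (ξ η : n → K), ∑ j, ‖ξ j‖ ^ 2 ≤ 1 ∧ ∑ i, ‖η i‖ ^ 2 ≤ 1 ∧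
      (∀ v ∈ V, ∀ i j, ⟪η i, π v (ξ j)⟫_ℂ = 0) ∧
      ∑ i, ∑ j, ⟪η i, π (X i j) (ξ j)⟫_ℂ
        = (Metric.infDist X (matrixSubmodule V n : Set (CStarMatrix n n A)) : ℂ) := by
  -- If the matrix algebra is zero (`A = 0` or `n` empty), the zero space serves.
  rcases subsingleton_or_nontrivial (CStarMatrix n n A) with hs | hnt
  · have hsub : Subsingleton (EuclideanSpace ℂ PEmpty.{u + 1}) := inferInstance
    refine ⟨EuclideanSpace ℂ PEmpty.{u + 1}, inferInstance, inferInstance, inferInstance,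
      { toFun := fun _ => 0
        map_one' := Subsingleton.elim _ _
        map_mul' := fun _ _ => Subsingleton.elim _ _
        map_zero' := rfl
        map_add' := fun _ _ => Subsingleton.elim _ _
        commutes' := fun _ => Subsingleton.elim _ _
        map_star' := fun _ => Subsingleton.elim _ _ }, 0, 0, by simp, by simp, by simp, ?_⟩
    rw [Subsingleton.elim X 0, Metric.infDist_zero_of_mem (matrixSubmodule V n).zero_mem]
    simp
  · obtain ⟨f, hf, hfW, hfX⟩ := exists_functional_eq_infDist (matrixSubmodule V n) X
    obtain ⟨K, _, _, _, σ, x, y, hx, hy, hσ⟩ := exists_representation_of_functional f hf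
    have hne : Nonempty n := by
      by_contra h
      rw [not_nonempty_iff] at h
      obtain ⟨a, b, hab⟩ := hnt.exists_pair_ne
      exact hab (CStarMatrix.ext fun i => isEmptyElim i)
    obtain ⟨k⟩ := hne
    have hunit : ∀ a i j, ⟪σ (CStarMatrix.unit k i 1) y,
        σ (CStarMatrix.diagonalStarAlgHom n A a) (σ (CStarMatrix.unit k j 1) x)⟫_ℂ
        = f (CStarMatrix.unit i j a) := by
      intro a i j
      have h1 : CStarMatrix.unit i j a = star (CStarMatrix.unit k i (1 : A)) *
          (CStarMatrix.diagonalStarAlgHom n A a * CStarMatrix.unit k j 1) := by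
        rw [CStarMatrix.diagonalStarAlgHom_mul_unit, CStarMatrix.star_unit,
          CStarMatrix.unit_mul_unit, star_one, one_mul, mul_one]
      rw [h1, hσ, map_mul, map_mul, map_star, mul_apply_eq_comp,
        mul_apply_eq_comp, ContinuousLinearMap.star_eq_adjoint,
        ContinuousLinearMap.adjoint_inner_right]
    refine ⟨K, inferInstance, inferInstance, inferInstance,
      σ.comp (CStarMatrix.diagonalStarAlgHom n A), fun j => σ (CStarMatrix.unit k j 1) x,
      fun i => σ (CStarMatrix.unit k i 1) y, ?_, ?_, fun v hv i j => ?_, ?_⟩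
    · rw [sum_norm_sq_unit_apply]
      exact pow_le_one₀ (norm_nonneg _) hx
    · rw [sum_norm_sq_unit_apply]
      exact pow_le_one₀ (norm_nonneg _) hy
    · refine (hunit v i j).trans (hfW _ fun p q => ?_)
      rw [CStarMatrix.unit_apply]
      split_ifs
      exacts [hv, V.zero_mem]
    · simp only [StarAlgHom.comp_apply, hunit]
      simp only [← map_sum]
      rw [CStarMatrix.sum_unit, hfX]

/-! ### Matrix norm estimates -/

/-- The matrix factors as `diag(p) diag(u) π_n(C) diag(p)`, and *-homomorphisms are contractive. -/
theorem CStarMatrix.norm_compression_le {A B : Type*} [CStarAlgebra A] [PartialOrder A]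
    [StarOrderedRing A] [CStarAlgebra B] [PartialOrder B] [StarOrderedRing B] {n : Type*}
    [Fintype n] [DecidableEq n] (π : A →⋆ₐ[ℂ] B) {p u : B} (hp : ‖p‖ ≤ 1) (hu : ‖u‖ ≤ 1)
    (C : CStarMatrix n n A) :
    ‖(CStarMatrix.ofMatrix fun i j => p * u * π (C i j) * p : CStarMatrix n n B)‖ ≤ ‖C‖ := by
  have h : (CStarMatrix.ofMatrix fun i j => p * u * π (C i j) * p : CStarMatrix n n B)
      = diagonalStarAlgHom n B p * diagonalStarAlgHom n B u
        * CStarMatrix.mapₙₐ (π : A →⋆ₙₐ[ℂ] B) C * diagonalStarAlgHom n B p := by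
    rw [← map_mul]
    ext i j
    refine Eq.symm ((Matrix.mul_diagonal _ _ _ _).trans ?_)
    exact congrArg (· * p) (Matrix.diagonal_mul _ _ _ _)
  have hd : ∀ b : B, ‖b‖ ≤ 1 → ‖diagonalStarAlgHom n B b‖ ≤ 1 := fun b hb =>
    (NonUnitalStarAlgHom.norm_apply_le (diagonalStarAlgHom n B) b).trans hb
  have hC : ‖CStarMatrix.mapₙₐ (n := n) (π : A →⋆ₙₐ[ℂ] B) C‖ ≤ ‖C‖ :=
    NonUnitalStarAlgHom.norm_apply_le _ C
  rw [h]
  refine (norm_mul_le _ _).trans ((mul_le_of_le_one_right (norm_nonneg _) (hd p hp)).trans ?_)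
  refine (norm_mul_le _ _).trans ((mul_le_of_le_one_left (norm_nonneg _) ?_).trans hC)
  exact (norm_mul_le _ _).trans (mul_le_one₀ (hd p hp) (norm_nonneg _) (hd u hu))

/-- The sum is one matrix coefficient of `M` acting on the ℓ²-sum of copies of `H`; contractivity of
that action suffices. -/
theorem CStarMatrix.norm_sum_inner_le {n H : Type*} [Fintype n] [DecidableEq n]
    [NormedAddCommGroup H] [InnerProductSpace ℂ H] [CompleteSpace H] [PartialOrder (H →L[ℂ] H)]
    [StarOrderedRing (H →L[ℂ] H)] (M : CStarMatrix n n (H →L[ℂ] H)) {ξ η : n → H}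
    (hξ : ∑ j, ‖ξ j‖ ^ 2 ≤ 1) (hη : ∑ i, ‖η i‖ ^ 2 ≤ 1) :
    ‖∑ i, ∑ j, ⟪η i, M i j (ξ j)⟫_ℂ‖ ≤ ‖M‖ := by
  obtain ⟨Θ, hΘ⟩ := exists_matrix_action n H
  have hsum : ∑ i, ∑ j, ⟪η i, M i j (ξ j)⟫_ℂ
      = ⟪WithLp.toLp 2 η, Θ M (WithLp.toLp 2 ξ)⟫_ℂ := by
    rw [PiLp.inner_apply]
    simp [hΘ, inner_sum]
  have hnorm : ∀ ζ : n → H, ∑ j, ‖ζ j‖ ^ 2 ≤ 1 → ‖WithLp.toLp 2 ζ‖ ≤ 1 := by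
    intro ζ hζ
    rw [PiLp.norm_eq_of_L2]
    exact Real.sqrt_le_one.mpr hζ
  rw [hsum]
  calc ‖⟪WithLp.toLp 2 η, Θ M (WithLp.toLp 2 ξ)⟫_ℂ‖
      ≤ ‖WithLp.toLp 2 η‖ * ‖Θ M (WithLp.toLp 2 ξ)‖ := norm_inner_le_norm _ _
    _ ≤ 1 * (‖Θ M‖ * 1) := by
        refine mul_le_mul (hnorm η hη) ?_ (norm_nonneg _) zero_le_one
        exact (ContinuousLinearMap.le_opNorm _ _).trans
          (mul_le_mul_of_nonneg_left (hnorm ξ hξ) (norm_nonneg _))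
    _ = ‖Θ M‖ := by ring
    _ ≤ ‖M‖ := NonUnitalStarAlgHom.norm_apply_le Θ M

/-! ### A representation with two projections -/

theorem mem_orthogonal_span {H : Type*} [NormedAddCommGroup H] [InnerProductSpace ℂ H] {S : Set H}
    {x : H} : x ∈ (Submodule.span ℂ S)ᗮ ↔ ∀ s ∈ S, ⟪s, x⟫_ℂ = 0 := by
  rw [Submodule.mem_orthogonal]
  refine ⟨fun h s hs => h s (Submodule.subset_span hs), fun h y hy => ?_⟩
  induction hy using Submodule.span_induction with
  | mem s hs => exact h s hs
  | zero => exact inner_zero_left _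
  | add a b _ _ ha hb => rw [inner_add_left, ha, hb, add_zero]
  | smul c a _ ha => rw [inner_smul_left, ha, mul_zero]

/-- The direct sum runs over all pairs `(n, X)`. Distinct summands are orthogonal and invariant, so
the orthogonality for `V` needs checking only within a summand. -/
theorem exists_representation_of_forall_infDist {A : Type u} [CStarAlgebra A] [PartialOrder A]
    [StarOrderedRing A] (V : Submodule ℂ A) :
    ∃ (L : Type u) (_ : NormedAddCommGroup L) (_ : InnerProductSpace ℂ L) (_ : CompleteSpace L)
      (σ : A →⋆ₐ[ℂ] (L →L[ℂ] L)) (S₁ S₂ : Set L),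
      (∀ v ∈ V, ∀ s ∈ S₁, ∀ t ∈ S₂, ⟪t, σ v s⟫_ℂ = 0) ∧
      ∀ (n : ℕ) (X : CStarMatrix (Fin n) (Fin n) A), ∃ ξ η : Fin n → L,
        (∀ j, ξ j ∈ S₁) ∧ (∀ i, η i ∈ S₂) ∧ ∑ j, ‖ξ j‖ ^ 2 ≤ 1 ∧ ∑ i, ‖η i‖ ^ 2 ≤ 1 ∧
        ∑ i, ∑ j, ⟪η i, σ (X i j) (ξ j)⟫_ℂ = (Metric.infDist X
          (matrixSubmodule V (Fin n) : Set (CStarMatrix (Fin n) (Fin n) A)) : ℂ) := by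
  classical
  choose K i1 i2 i3 π ξ η hξ hη hV hX using
    fun p : (Σ n : ℕ, CStarMatrix (Fin n) (Fin n) A) => exists_representation_of_infDist V p.2
  obtain ⟨σ, hσ⟩ := exists_directSum_representation π
  have hinner : ∀ p x y a, ⟪lp.single 2 p y, σ a (lp.single 2 p x)⟫_ℂ = ⟪y, π p a x⟫_ℂ := by
    intro p x y a
    rw [lp.inner_single_left, hσ, lp.single_apply_self]
  refine ⟨lp K 2, inferInstance, inferInstance, inferInstance, σ,
    {s | ∃ p j, s = lp.single 2 p (ξ p j)}, {t | ∃ p j, t = lp.single 2 p (η p j)}, ?_, ?_⟩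
  · rintro v hv _ ⟨p, j, rfl⟩ _ ⟨q, i, rfl⟩
    rw [lp.inner_single_left, hσ]
    by_cases h : q = p
    · subst h
      rw [lp.single_apply_self, hV q v hv]
    · rw [lp.single_apply_ne _ _ _ h, map_zero, inner_zero_right]
  · intro n X
    refine ⟨fun j => lp.single 2 ⟨n, X⟩ (ξ ⟨n, X⟩ j), fun i => lp.single 2 ⟨n, X⟩ (η ⟨n, X⟩ i),
      fun j => ⟨⟨n, X⟩, j, rfl⟩, fun i => ⟨⟨n, X⟩, i, rfl⟩, ?_, ?_, ?_⟩
    · simpa only [lp.norm_single (by norm_num : (0 : ENNReal) < 2)] using hξ ⟨n, X⟩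
    · simpa only [lp.norm_single (by norm_num : (0 : ENNReal) < 2)] using hη ⟨n, X⟩
    · simp only [hinner]
      exact hX ⟨n, X⟩

/-- There is a representation with projections `p`, `q` such that `q σ(·) p` vanishes on `V` and
norms the matrix spaces over `A ⧸ V`. -/
theorem exists_representation_projections {A : Type u} [CStarAlgebra A] [PartialOrder A]
    [StarOrderedRing A] (V : Submodule ℂ A) :
    ∃ (L : Type u) (_ : NormedAddCommGroup L) (_ : InnerProductSpace ℂ L) (_ : CompleteSpace L)
      (σ : A →⋆ₐ[ℂ] (L →L[ℂ] L)) (p q : L →L[ℂ] L), IsStarProjection p ∧ IsStarProjection q ∧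
      (∀ v ∈ V, q * σ v * p = 0) ∧
      ∀ (n : ℕ) (X : CStarMatrix (Fin n) (Fin n) A), ∃ ξ η : Fin n → L,
        ∑ j, ‖ξ j‖ ^ 2 ≤ 1 ∧ ∑ i, ‖η i‖ ^ 2 ≤ 1 ∧
        ∑ i, ∑ j, ⟪η i, (q * σ (X i j) * p) (ξ j)⟫_ℂ = (Metric.infDist X
          (matrixSubmodule V (Fin n) : Set (CStarMatrix (Fin n) (Fin n) A)) : ℂ) := by
  obtain ⟨L, _, _, _, σ, S₁, S₂, hV, hX⟩ := exists_representation_of_forall_infDist V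
  -- `M₁` is the largest subspace that `σ(V)` maps into the complement of `S₂`, hence contains `S₁`;
  -- `M₂` is the complement of `σ(V) M₁`, hence contains `S₂`.
  let M₁ := (Submodule.span ℂ {z | ∃ v ∈ V, ∃ t ∈ S₂, z = star (σ v) t})ᗮ
  let M₂ := (Submodule.span ℂ {z | ∃ v ∈ V, ∃ s ∈ M₁, z = σ v s})ᗮ
  have hS₁ : S₁ ⊆ M₁ := fun s hs => mem_orthogonal_span.mpr <| by
    rintro _ ⟨v, hv, t, ht, rfl⟩
    rw [ContinuousLinearMap.star_eq_adjoint, ContinuousLinearMap.adjoint_inner_left]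
    exact hV v hv s hs t ht
  have hS₂ : S₂ ⊆ M₂ := fun t ht => mem_orthogonal_span.mpr <| by
    rintro _ ⟨v, hv, s, hs, rfl⟩
    rw [← ContinuousLinearMap.adjoint_inner_right, ← ContinuousLinearMap.star_eq_adjoint,
      ← inner_conj_symm, mem_orthogonal_span.mp hs _ ⟨v, hv, t, ht, rfl⟩, map_zero]
  refine ⟨L, inferInstance, inferInstance, inferInstance, σ, M₁.starProjection, M₂.starProjection,
    isStarProjection_starProjection, isStarProjection_starProjection, fun v hv => ?_,
    fun n X => ?_⟩
  · ext x
    rw [mul_apply_eq_comp, mul_apply_eq_comp, zero_apply]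
    refine (Submodule.starProjection_apply_eq_zero_iff _).mpr ?_
    refine Submodule.le_orthogonal_orthogonal _ (Submodule.subset_span ?_)
    exact ⟨v, hv, _, Submodule.starProjection_apply_mem _ _, rfl⟩
  · obtain ⟨ξ, η, h1, h2, h3, h4, h5⟩ := hX n X
    refine ⟨ξ, η, h3, h4, ?_⟩
    rw [← h5]
    refine Finset.sum_congr rfl fun i _ => Finset.sum_congr rfl fun j _ => ?_
    rw [mul_apply_eq_comp, mul_apply_eq_comp,
      Submodule.starProjection_eq_self_iff.mpr (hS₁ (h1 j)),
      ← Submodule.inner_starProjection_left_eq_right,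
      Submodule.starProjection_eq_self_iff.mpr (hS₂ (h2 i))]

/-- The distance of a matrix to the matrices over `V` dominates the quotient matrix norm. -/
theorem quotientMatrixNorm_le_infDist {A : Type*} [CStarAlgebra A] (V : Submodule ℂ A) {n : ℕ}
    (C : Matrix (Fin n) (Fin n) A) :
    letI : PartialOrder A := CStarAlgebra.spectralOrder A
    letI : StarOrderedRing A := CStarAlgebra.spectralOrderedRing A
    quotientMatrixNorm V n (C.map V.mkQ) ≤ Metric.infDist (CStarMatrix.ofMatrix C)
      (matrixSubmodule V (Fin n) : Set (CStarMatrix (Fin n) (Fin n) A)) := by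
  let _ : PartialOrder A := CStarAlgebra.spectralOrder A
  let _ : StarOrderedRing A := CStarAlgebra.spectralOrderedRing A
  refine (Metric.le_infDist ⟨0, (matrixSubmodule V (Fin n)).zero_mem⟩).mpr fun D hD => ?_
  -- Subtracting `D ∈ M_n(V)` from `C` gives another lift, of norm `dist C D`.
  refine csInf_le ⟨0, ?_⟩ ⟨C - CStarMatrix.ofMatrix.symm D, ?_, ?_⟩
  · rintro _ ⟨C', _, rfl⟩
    exact norm_nonneg _
  · ext i j
    have h : V.mkQ (D i j) = 0 := by
      rw [Submodule.mkQ_apply, Submodule.Quotient.mk_eq_zero]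
      exact hD i j
    change V.mkQ (C i j - D i j) = V.mkQ (C i j)
    rw [map_sub, h, sub_zero]
  · rw [dist_eq_norm]
    rfl

end

/-! ### Symmetrization on `L ⊕ L` -/

theorem theorem2p3 {A : Type u} [CStarAlgebra A] (V : Submodule ℂ A)
    (hclosed : IsClosed (V : Set A)) (hstar : ∀ a ∈ V, star a ∈ V) :
    ∃ (H : Type u) (_ : NormedAddCommGroup H) (_ : InnerProductSpace ℂ H) (_ : CompleteSpace H)
      (π : A →⋆ₐ[ℂ] (H →L[ℂ] H)) (P U : H →L[ℂ] H),
      IsStarProjection P ∧ IsSelfAdjoint U ∧ U ∈ unitary (H →L[ℂ] H) ∧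
      (∀ a : A, Commute U (π a)) ∧
      ∃ Φ : (A ⧸ V) →ₗ[ℂ] (H →L[ℂ] H),
        (∀ a : A, Φ (V.mkQ a) = P * U * π a * P) ∧
        (∀ x : A ⧸ V, Φ (quotientStar V hstar x) = star (Φ x)) ∧
        (∀ T ∈ LinearMap.range Φ, star T ∈ LinearMap.range Φ) ∧
        IsCompleteIsometry (quotientMatrixNorm V) (cstarMatrixNorm (H →L[ℂ] H)) Φ := by
  let _ : PartialOrder A := CStarAlgebra.spectralOrder A
  let _ : StarOrderedRing A := CStarAlgebra.spectralOrderedRing A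
  obtain ⟨L, _, _, _, σ, p, q, hp, hq, hV, hdist⟩ := exists_representation_projections V
  obtain ⟨Θ, hΘ⟩ := exists_matrix_action (Fin 2) L
  let H := PiLp 2 (fun _ : Fin 2 => L)
  let p₂ : CStarMatrix (Fin 2) (Fin 2) (L →L[ℂ] L) := CStarMatrix.ofMatrix !![p, 0; 0, q]
  let u₂ : CStarMatrix (Fin 2) (Fin 2) (L →L[ℂ] L) := CStarMatrix.ofMatrix !![0, 1; 1, 0]
  have hp₂ : IsStarProjection p₂ := by
    refine ⟨?_, ?_⟩
    · ext1 i j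
      rw [CStarMatrix.mul_apply]
      fin_cases i <;> fin_cases j <;>
        simp [p₂, CStarMatrix.ofMatrix_apply, hp.isIdempotentElem.eq, hq.isIdempotentElem.eq]
    · ext1 i j
      rw [CStarMatrix.star_apply]
      fin_cases i <;> fin_cases j <;>
        simp [p₂, CStarMatrix.ofMatrix_apply, hp.isSelfAdjoint.star_eq, hq.isSelfAdjoint.star_eq]
  have hu₂ : star u₂ = u₂ := by
    ext1 i j
    rw [CStarMatrix.star_apply]
    fin_cases i <;> fin_cases j <;> simp [u₂, CStarMatrix.ofMatrix_apply]
  have hu₂' : u₂ * u₂ = 1 := by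
    ext1 i j
    rw [CStarMatrix.mul_apply]
    fin_cases i <;> fin_cases j <;> simp [u₂, CStarMatrix.ofMatrix_apply]
  have hcomm : ∀ b, u₂ * CStarMatrix.diagonalStarAlgHom (Fin 2) _ b
      = CStarMatrix.diagonalStarAlgHom (Fin 2) _ b * u₂ := by
    intro b
    ext1 i j
    rw [CStarMatrix.mul_apply, CStarMatrix.mul_apply]
    fin_cases i <;> fin_cases j <;>
      simp [u₂, CStarMatrix.ofMatrix_apply, CStarMatrix.diagonalStarAlgHom_apply]
  have hcorner : ∀ b, p₂ * u₂ * CStarMatrix.diagonalStarAlgHom (Fin 2) _ b * p₂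
      = CStarMatrix.ofMatrix !![0, p * b * q; q * b * p, 0] := by
    intro b
    ext1 i j
    fin_cases i <;> fin_cases j <;>
      simp [p₂, u₂, CStarMatrix.ofMatrix_apply, CStarMatrix.diagonalStarAlgHom_apply,
        CStarMatrix.mul_apply]
  let π : A →⋆ₐ[ℂ] (H →L[ℂ] H) := (Θ.comp (CStarMatrix.diagonalStarAlgHom (Fin 2) _)).comp σ
  have hπ : ∀ a, π a = Θ (CStarMatrix.diagonalStarAlgHom (Fin 2) _ (σ a)) := fun _ => rfl
  have hP : IsStarProjection (Θ p₂) := hp₂.map Θ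
  have hU : star (Θ u₂) = Θ u₂ := by rw [← map_star, hu₂]
  have hUU : Θ u₂ * Θ u₂ = 1 := by rw [← map_mul, hu₂', map_one]
  have hUπ : ∀ a, Θ u₂ * π a = π a * Θ u₂ := fun a => by
    rw [hπ, ← map_mul, ← map_mul, hcomm]
  have hcompr : ∀ a, Θ p₂ * Θ u₂ * π a * Θ p₂
      = Θ (CStarMatrix.ofMatrix !![0, p * σ a * q; q * σ a * p, 0]) := fun a => by
    rw [hπ, ← map_mul, ← map_mul, ← map_mul, hcorner]
  let Ψ : A →ₗ[ℂ] (H →L[ℂ] H) :=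
    LinearMap.mulRight ℂ (Θ p₂) ∘ₗ LinearMap.mulLeft ℂ (Θ p₂ * Θ u₂) ∘ₗ
      (π : A →ₐ[ℂ] (H →L[ℂ] H)).toLinearMap
  have hΨ : ∀ a, Ψ a = Θ p₂ * Θ u₂ * π a * Θ p₂ := fun _ => rfl
  have hker : V ≤ LinearMap.ker Ψ := by
    intro v hv
    -- The adjoint of `q σ(v⋆) p = 0`; here star-stability of `V` enters.
    have h1 : p * σ v * q = 0 := by
      have := congrArg star (hV (star v) (hstar v hv))
      rwa [star_mul, star_mul, map_star, star_star, hp.isSelfAdjoint.star_eq,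
        hq.isSelfAdjoint.star_eq, star_zero, ← mul_assoc] at this
    have h2 : (CStarMatrix.ofMatrix !![0, p * σ v * q; q * σ v * p, 0] :
        CStarMatrix (Fin 2) (Fin 2) (L →L[ℂ] L)) = 0 := by
      rw [h1, hV v hv]
      ext1 i j
      fin_cases i <;> fin_cases j <;> rfl
    rw [LinearMap.mem_ker, hΨ, hcompr, h2, map_zero]
  have hΦstar : ∀ x : A ⧸ V, V.liftQ Ψ hker (quotientStar V hstar x)
      = star (V.liftQ Ψ hker x) := by
    intro x
    obtain ⟨a, rfl⟩ := V.mkQ_surjective x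
    rw [quotientStar_mkQ, Submodule.mkQ_apply, Submodule.mkQ_apply, Submodule.liftQ_apply,
      Submodule.liftQ_apply, hΨ, hΨ, star_mul, star_mul, star_mul, hP.isSelfAdjoint.star_eq, hU,
      ← map_star, ← mul_assoc, mul_assoc (Θ p₂), hUπ, ← mul_assoc, ← mul_assoc]
  refine ⟨H, inferInstance, inferInstance, inferInstance, π, Θ p₂, Θ u₂, hP, hU,
    Unitary.mem_iff.mpr ⟨by rw [hU, hUU], by rw [hU, hUU]⟩, hUπ, V.liftQ Ψ hker,
    fun a => rfl, hΦstar, ?_, fun n X => ?_⟩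
  · rintro _ ⟨x, rfl⟩
    exact ⟨_, hΦstar x⟩
  · let _ : PartialOrder (H →L[ℂ] H) := CStarAlgebra.spectralOrder _
    let _ : StarOrderedRing (H →L[ℂ] H) := CStarAlgebra.spectralOrderedRing _
    have hlift : ∀ C : Matrix (Fin n) (Fin n) A, (C.map V.mkQ).map (V.liftQ Ψ hker)
        = fun i j => Θ p₂ * Θ u₂ * π (C i j) * Θ p₂ := fun C => rfl
    obtain ⟨C, rfl⟩ : ∃ C : Matrix (Fin n) (Fin n) A, C.map V.mkQ = X := by
      choose C hC using fun i j => V.mkQ_surjective (X i j)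
      exact ⟨C, Matrix.ext hC⟩
    -- Upper bound: every lift is compressed by contractions. Lower bound: the norming vectors,
    -- placed as `(ξ_j, 0)` and `(0, η_i)`, pick out the corner `q σ(·) p`.
    refine le_antisymm (le_csInf ⟨_, C, rfl, rfl⟩ ?_) ?_
    · rintro _ ⟨C', hC', rfl⟩
      rw [← hC', hlift]
      refine CStarMatrix.norm_compression_le π hP.norm_le ?_ (CStarMatrix.ofMatrix C')
      -- Only `≤`, since `H` may be zero; then `‖U‖² = ‖1‖ ≤ 1`.
      have h1 : ‖(1 : H →L[ℂ] H)‖ ≤ 1 := ContinuousLinearMap.norm_id_le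
      have h2 := CStarRing.norm_star_mul_self (x := Θ u₂)
      rw [hU, hUU] at h2
      nlinarith [norm_nonneg (Θ u₂)]
    · refine (quotientMatrixNorm_le_infDist V C).trans ?_
      obtain ⟨ξ, η, hξ, hη, h⟩ := hdist n (CStarMatrix.ofMatrix C)
      have hdnn := Metric.infDist_nonneg (x := CStarMatrix.ofMatrix C)
        (s := (matrixSubmodule V (Fin n) : Set (CStarMatrix (Fin n) (Fin n) A)))
      rw [hlift]
      have hnorm₁ : ∀ x : L, ‖(WithLp.toLp 2 ![x, 0] : PiLp 2 (fun _ : Fin 2 => L))‖ = ‖x‖ := by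
        simp [PiLp.norm_eq_of_L2]
      have hnorm₂ : ∀ x : L, ‖(WithLp.toLp 2 ![0, x] : PiLp 2 (fun _ : Fin 2 => L))‖ = ‖x‖ := by
        simp [PiLp.norm_eq_of_L2]
      have hinner : ∀ a x y, inner ℂ (WithLp.toLp 2 ![0, y] : PiLp 2 (fun _ : Fin 2 => L))
          ((Θ p₂ * Θ u₂ * π a * Θ p₂) (WithLp.toLp 2 ![x, 0]))
          = inner ℂ y ((q * σ a * p) x) := by
        intro a x y
        rw [hcompr, PiLp.inner_apply, Fin.sum_univ_two, hΘ, hΘ]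
        simp [CStarMatrix.ofMatrix_apply]
      have hle := CStarMatrix.norm_sum_inner_le (H := H)
        (CStarMatrix.ofMatrix fun i j => Θ p₂ * Θ u₂ * π (C i j) * Θ p₂)
        (ξ := fun j => WithLp.toLp 2 ![ξ j, 0]) (η := fun i => WithLp.toLp 2 ![0, η i])
        (by simpa only [hnorm₁] using hξ) (by simpa only [hnorm₂] using hη)
      refine le_trans (le_of_eq ?_) hle
      rw [← Complex.norm_of_nonneg hdnn, ← h]
      congr 1
      exact Finset.sum_congr rfl fun i _ => Finset.sum_congr rfl fun j _ =>
        (hinner (C i j) (ξ j) (η i)).symm
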